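/- Let $V$ be a real vector space equipped with a vector ordering $\preceq$ (a partial order compatible with addition and with multiplication by non-negative reals), let $\prec$ be its strict part and let $V_{\succ 0}=\{u\in V: u\succ 0\}$. Let $\mathcal Q$ be the set of all finite subsets of $V$, including $\emptyset$. For $S\subseteq V$ let $\mathrm{posi}(S)=\{\sum_{k=1}^n\lambda_k u_k : n\ge 1,\ \lambda_k>0,\ u_k\in S\}$, and write $(\lambda,\mu)>0$ for '$\lambda\ge 0$, $\mu\ge 0$ and $\lambda+\mu>0$'. A set $K\subseteq\mathcal Q$ is called \emph{coherent} if: (K$_0$) $A\in K$ implies $A\setminus\{0\}\in K$; (K$_1$) $\{0\}\notin K$; (K$_2$) $\{u\}\in K$ for all $u\in V_{\succ 0}$; (K$_3$) if $A_1,A_2\in K$ and $(\lambda_{u,v},\mu_{u,v})>0$ for all $u\in A_1$, $v\in A_2$, then $\{\lambda_{u,v}u+\mu_{u,v}v : u\in A_1, v\in A_2\}\in K$; (K$_4$) if $A_1\in K$ and $A_1\subseteq A_2\in\mathcal Q$ then $A_2\in K$. It is called \emph{mixing} if it is coherent and (K$_{\mathrm M}$) for all $A,B\in\mathcal Q$,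 if $B\in K$ and $A\subseteq B\subseteq\mathrm{posi}(A)$, then $A\in K$. A set $D\subseteq V$ is called \emph{coherent} if $0\notin D$, $V_{\succ 0}\subseteq D$, and $\lambda u+\mu v\in D$ whenever $u,v\in D$ and $(\lambda,\mu)>0$. It is called \emph{mixing} if it is coherent and, for all $A\in\mathcal Q$, $\mathrm{posi}(A)\cap D\ne\emptyset$ implies $A\cap D\neq\emptyset$. It is called \emph{lexicographic} if it is coherent and $\mathrm{posi}(V\setminus D)=V\setminus D$. For $D\subseteq V$ let $K_D=\{A\in\mathcal Q: A\cap D\ne\emptyset\}$. Then the following hold. (i) A set $K\subseteq\mathcal Q$ is mixing if and only if there is a non-empty set $\mathcal D$ of mixing sets $D\subseteq V$ such that $K=\bigcap_{D\in\mathcal D}K_D$. (ii) If $K$ is mixing, then the largest such $\mathcal D$ (with respect to inclusion) is $\{D\subseteq V : D\text{ is mixing and } K\subseteq K_D\}$. (iii) A set $D\subseteq V$ is mixing if and only if it is lexicographic. -/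

import Mathlib

namespace ChoiceModels

/-- The set `posi S` of all positive linear combinations `∑ k, c k • u k` of `n ≥ 1` elements of
`S`, with all coefficients strictly positive. -/
def posi {V : Type*} [AddCommGroup V] [Module ℝ V] (S : Set V) : Set V :=
  {x | ∃ n : ℕ, 0 < n ∧ ∃ (c : Fin n → ℝ) (u : Fin n → V),
    (∀ k, 0 < c k) ∧ (∀ k, u k ∈ S) ∧ x = ∑ k, c k • u k}

/-- The shorthand `(l, m) > 0` for pairs of reals. -/
def PairPos (l m : ℝ) : Prop := 0 ≤ l ∧ 0 ≤ m ∧ 0 < l + m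

open scoped Classical in
/-- Coherent sets of desirable option sets. Option sets are finite sets of options (possibly
empty), and the background strict order on options is the order `<` of `V`. -/
structure CoherentOptionSets {V : Type*} [AddCommGroup V] [PartialOrder V] [Module ℝ V]
    (K : Set (Finset V)) : Prop where
  remove_zero : ∀ A : Finset V, A ∈ K → A \ {0} ∈ K
  zero_notMem : ({0} : Finset V) ∉ K
  pos_mem : ∀ u : V, 0 < u → ({u} : Finset V) ∈ K
  combine : ∀ A₁ ∈ K, ∀ A₂ ∈ K, ∀ l m : V → V → ℝ,
    (∀ u ∈ A₁, ∀ v ∈ A₂, PairPos (l u v) (m u v)) →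
      Finset.image₂ (fun u v => l u v • u + m u v • v) A₁ A₂ ∈ K
  mono : ∀ A₁ A₂ : Finset V, A₁ ∈ K → A₁ ⊆ A₂ → A₂ ∈ K

/-- Mixing sets of desirable option sets: coherent, and closed under removing options that are
positive linear combinations of the remaining ones. -/
structure MixingOptionSets {V : Type*} [AddCommGroup V] [PartialOrder V] [Module ℝ V]
    (K : Set (Finset V)) : Prop where
  coherent : CoherentOptionSets K
  remove_posi : ∀ A B : Finset V, B ∈ K → A ⊆ B → (B : Set V) ⊆ posi (A : Set V) → A ∈ K

/-- Coherent sets of desirable options. -/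
structure CoherentOptions {V : Type*} [AddCommGroup V] [PartialOrder V] [Module ℝ V]
    (D : Set V) : Prop where
  zero_notMem : (0 : V) ∉ D
  pos_mem : ∀ u : V, 0 < u → u ∈ D
  combine : ∀ u ∈ D, ∀ v ∈ D, ∀ l m : ℝ, PairPos l m → l • u + m • v ∈ D

/-- Mixing sets of desirable options. -/
structure MixingOptions {V : Type*} [AddCommGroup V] [PartialOrder V] [Module ℝ V]
    (D : Set V) : Prop where
  coherent : CoherentOptions D
  mixing : ∀ A : Finset V, (posi (A : Set V) ∩ D).Nonempty → ((A : Set V) ∩ D).Nonempty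

/-- Lexicographic sets of desirable options: coherent, with a complement that is again a convex
cone. -/
structure LexicographicOptions {V : Type*} [AddCommGroup V] [PartialOrder V] [Module ℝ V]
    (D : Set V) : Prop where
  coherent : CoherentOptions D
  posi_compl : posi Dᶜ = Dᶜ

/-- The binary set of desirable option sets `K_D`: all option sets that meet `D`. -/
def binaryOptionSets {V : Type*} (D : Set V) : Set (Finset V) :=
  {A | ((A : Set V) ∩ D).Nonempty}

/-- The family `𝒟` is a non-empty family of mixing sets of desirable options and `K` is the
intersection of the sets `K_D` with `D ∈ 𝒟`. -/
structure IsMixingRepresentation {V : Type*} [AddCommGroup V] [PartialOrder V] [Module ℝ V]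
    (K : Set (Finset V)) (𝒟 : Set (Set V)) : Prop where
  nonempty : 𝒟.Nonempty
  mixing : ∀ D ∈ 𝒟, MixingOptions D
  eq_iInter : K = ⋂ D ∈ 𝒟, binaryOptionSets D

end ChoiceModels

/-!
That `K ⊆ binaryOptionSets D` means that `D` meets every option set in `K`, that is, `D` is a
transversal of `K`. For `A ∉ K`, closure of `K` under supersets makes `Aᶜ` a transversal, and by
Zorn's lemma it contains a minimal one, `D`: a finite set that meets every member of a chain meets
its intersection. By minimality every `u ∈ D` is the only point of `D` in some `A ∈ K`, and this
turns each axiom on `K` into the corresponding axiom on `D`. So `D` is mixing and separates `A`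
from `K`.
-/

namespace ChoiceModels

section Posi

variable {V : Type*} [AddCommGroup V] [Module ℝ V]

theorem subset_posi (S : Set V) : S ⊆ posi S := fun x hx =>
  ⟨1, one_pos, fun _ => 1, fun _ => x, fun _ => one_pos, fun _ => hx, by simp⟩

theorem posi_mono {S T : Set V} (h : S ⊆ T) : posi S ⊆ posi T := by
  rintro x ⟨n, hn, c, u, hc, hu, rfl⟩
  exact ⟨n, hn, c, u, hc, fun k => h (hu k), rfl⟩

theorem exists_finset_subset_mem_posi {S : Set V} {x : V} (hx : x ∈ posi S) :
    ∃ A : Finset V, (A : Set V) ⊆ S ∧ x ∈ posi (A : Set V) := by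
  obtain ⟨n, hn, c, u, hc, hu, rfl⟩ := hx
  refine ⟨(Set.finite_range u).toFinset, ?_, n, hn, c, u, hc, fun k => by simp, rfl⟩
  simpa [Set.range_subset_iff] using hu

end Posi

section Transversal

variable {V : Type*} {K : Set (Finset V)} {D : Set V}

theorem subset_binaryOptionSets_sInter {c : Set (Set V)} (hne : c.Nonempty)
    (hchain : IsChain (· ⊆ ·) c) (hc : ∀ D ∈ c, K ⊆ binaryOptionSets D) :
    K ⊆ binaryOptionSets (⋂₀ c) := by
  intro A hA
  by_contra hAc
  have hcover : (A : Set V) ⊆ ⋃ D ∈ c, Dᶜ := fun x hx => by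
    have hxc : x ∉ ⋂₀ c := fun hxc => hAc ⟨x, hx, hxc⟩
    simpa using hxc
  have hdir : DirectedOn (fun D E : Set V => Dᶜ ⊆ Eᶜ) c := fun D hD E hE =>
    (hchain.total hD hE).elim
      (fun h => ⟨D, hD, subset_rfl, Set.compl_subset_compl.2 h⟩)
      (fun h => ⟨E, hE, Set.compl_subset_compl.2 h, subset_rfl⟩)
  obtain ⟨D, hD, hAD⟩ := hdir.exists_mem_subset_of_finset_subset_biUnion hne hcover
  obtain ⟨x, hxA, hxD⟩ := hc D hD hA
  exact hAD hxA hxD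

theorem exists_subset_minimal_transversal (hKD : K ⊆ binaryOptionSets D) :
    ∃ E ⊆ D, Minimal (K ⊆ binaryOptionSets ·) E :=
  zorn_superset_nonempty {E | K ⊆ binaryOptionSets E}
    (fun c hc hchain hne =>
      ⟨⋂₀ c, subset_binaryOptionSets_sInter hne hchain hc, fun _ => Set.sInter_subset_of_mem⟩)
    D hKD

theorem exists_mem_inter_eq_singleton (hD : Minimal (K ⊆ binaryOptionSets ·) D) {u : V}
    (hu : u ∈ D) : ∃ A ∈ K, (A : Set V) ∩ D = {u} := by
  obtain ⟨A, hA, hAD⟩ : ∃ A ∈ K, A ∉ binaryOptionSets (D \ {u}) :=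
    Set.not_subset.1 fun h => (hD.le_of_le h Set.sdiff_subset hu).2 rfl
  refine ⟨A, hA, (hD.prop hA).subset_singleton_iff.1 fun x hx => ?_⟩
  by_contra hxu
  exact hAD ⟨x, hx.1, hx.2, hxu⟩

end Transversal

section Mixing

variable {V : Type*} [AddCommGroup V] [PartialOrder V] [Module ℝ V]
  {K : Set (Finset V)} {D : Set V} {𝒟 : Set (Set V)}

theorem mixingOptions_iff_lexicographicOptions : MixingOptions D ↔ LexicographicOptions D := by
  refine ⟨fun h => ⟨h.coherent, (subset_posi _).antisymm' fun x hx hxD => ?_⟩,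
    fun h => ⟨h.coherent, fun A ⟨x, hxA, hxD⟩ => ?_⟩⟩
  · obtain ⟨A, hAD, hxA⟩ := exists_finset_subset_mem_posi hx
    obtain ⟨y, hyA, hyD⟩ := h.mixing A ⟨x, hxA, hxD⟩
    exact hAD hyA hyD
  · by_contra hA
    have hAD : (A : Set V) ⊆ Dᶜ := fun y hy hyD => hA ⟨y, hy, hyD⟩
    have hx : x ∈ Dᶜ := h.posi_compl ▸ posi_mono hAD hxA
    exact hx hxD

open scoped Classical in
theorem CoherentOptions.coherentOptionSets_binaryOptionSets (h : CoherentOptions D) :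
    CoherentOptionSets (binaryOptionSets D) where
  remove_zero := by
    rintro A ⟨x, hxA, hxD⟩
    have hx0 : x ≠ 0 := ne_of_mem_of_not_mem hxD h.zero_notMem
    exact ⟨x, by simpa using ⟨hxA, hx0⟩, hxD⟩
  zero_notMem := by
    rintro ⟨x, hx, hxD⟩
    obtain rfl : x = 0 := by simpa using hx
    exact h.zero_notMem hxD
  pos_mem u hu := ⟨u, by simp, h.pos_mem u hu⟩
  combine := by
    rintro A₁ ⟨u, hu, huD⟩ A₂ ⟨v, hv, hvD⟩ l m hlm
    exact ⟨_, Finset.mem_image₂_of_mem hu hv, h.combine u huD v hvD _ _ (hlm u hu v hv)⟩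
  mono := fun _ _ ⟨x, hx, hxD⟩ hA => ⟨x, hA hx, hxD⟩

theorem MixingOptions.mixingOptionSets_binaryOptionSets (h : MixingOptions D) :
    MixingOptionSets (binaryOptionSets D) where
  coherent := h.coherent.coherentOptionSets_binaryOptionSets
  remove_posi := fun A _ ⟨x, hx, hxD⟩ _ hB => h.mixing A ⟨x, hB hx, hxD⟩

theorem CoherentOptionSets.iInter {ι : Sort*} [Nonempty ι] {K : ι → Set (Finset V)}
    (h : ∀ i, CoherentOptionSets (K i)) : CoherentOptionSets (⋂ i, K i) where
  remove_zero A hA := Set.mem_iInter.2 fun i => (h i).remove_zero A (Set.mem_iInter.1 hA i)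
  zero_notMem h0 :=
    let ⟨i⟩ := ‹Nonempty ι›
    (h i).zero_notMem (Set.mem_iInter.1 h0 i)
  pos_mem u hu := Set.mem_iInter.2 fun i => (h i).pos_mem u hu
  combine A₁ h₁ A₂ h₂ l m hlm := Set.mem_iInter.2 fun i =>
    (h i).combine A₁ (Set.mem_iInter.1 h₁ i) A₂ (Set.mem_iInter.1 h₂ i) l m hlm
  mono A₁ A₂ h₁ hA := Set.mem_iInter.2 fun i => (h i).mono A₁ A₂ (Set.mem_iInter.1 h₁ i) hA

theorem MixingOptionSets.iInter {ι : Sort*} [Nonempty ι] {K : ι → Set (Finset V)}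
    (h : ∀ i, MixingOptionSets (K i)) : MixingOptionSets (⋂ i, K i) where
  coherent := .iInter fun i => (h i).coherent
  remove_posi A B hB hAB hBA := Set.mem_iInter.2 fun i =>
    (h i).remove_posi A B (Set.mem_iInter.1 hB i) hAB hBA

theorem IsMixingRepresentation.mixingOptionSets (h : IsMixingRepresentation K 𝒟) :
    MixingOptionSets K := by
  have : Nonempty 𝒟 := h.nonempty.to_subtype
  rw [h.eq_iInter, Set.biInter_eq_iInter]
  exact .iInter fun D => (h.mixing D D.2).mixingOptionSets_binaryOptionSets

open scoped Classical in
theorem CoherentOptionSets.combine_mem_of_inter_eq_singleton (hK : CoherentOptionSets K)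
    (hKD : K ⊆ binaryOptionSets D) {A₁ A₂ : Finset V} (hA₁ : A₁ ∈ K) (hA₂ : A₂ ∈ K) {u v : V}
    (hu : (A₁ : Set V) ∩ D = {u}) (hv : (A₂ : Set V) ∩ D = {v}) {l m : ℝ} (hlm : PairPos l m) :
    l • u + m • v ∈ D := by
  -- Pairs other than `(u, v)` are sent to one of their entries outside `D`, so that only the
  -- combination of `u` and `v` can lie in `D`.
  let l' : V → V → ℝ := fun x y => if x ∈ D then if y ∈ D then l else 0 else 1
  let m' : V → V → ℝ := fun x y => if x ∈ D then if y ∈ D then m else 1 else 0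
  have hpos (x y : V) : PairPos (l' x y) (m' x y) := by
    dsimp only [l', m']
    split_ifs
    exacts [hlm, ⟨le_rfl, zero_le_one, by norm_num⟩, ⟨zero_le_one, le_rfl, by norm_num⟩]
  obtain ⟨z, hz, hzD⟩ := hKD (hK.combine A₁ hA₁ A₂ hA₂ l' m' fun x _ y _ => hpos x y)
  obtain ⟨x, hx, y, hy, rfl⟩ := Finset.mem_image₂.1 hz
  have hxD : x ∈ D := by
    by_contra hxD
    simp [l', m', hxD] at hzD
  have hyD : y ∈ D := by
    by_contra hyD
    simp [l', m', hxD, hyD] at hzD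
  obtain rfl : x = u := hu.subset ⟨hx, hxD⟩
  obtain rfl : y = v := hv.subset ⟨hy, hyD⟩
  simpa [l', m', hxD, hyD] using hzD

theorem CoherentOptionSets.coherentOptions_of_minimal (hK : CoherentOptionSets K)
    (hD : Minimal (K ⊆ binaryOptionSets ·) D) : CoherentOptions D where
  zero_notMem h0 := by
    obtain ⟨A, hA, hAD⟩ := exists_mem_inter_eq_singleton hD h0
    obtain ⟨x, hx, hxD⟩ := hD.prop (hK.remove_zero A hA)
    obtain ⟨hxA, hx0⟩ : x ∈ A ∧ x ≠ 0 := by simpa using hx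
    exact hx0 (hAD.subset ⟨hxA, hxD⟩)
  pos_mem u hu := by
    obtain ⟨x, hx, hxD⟩ := hD.prop (hK.pos_mem u hu)
    obtain rfl : x = u := by simpa using hx
    exact hxD
  combine u hu v hv l m hlm := by
    obtain ⟨A₁, hA₁, hA₁D⟩ := exists_mem_inter_eq_singleton hD hu
    obtain ⟨A₂, hA₂, hA₂D⟩ := exists_mem_inter_eq_singleton hD hv
    exact hK.combine_mem_of_inter_eq_singleton hD.prop hA₁ hA₂ hA₁D hA₂D hlm

open scoped Classical in
theorem MixingOptionSets.erase_union_mem (hK : MixingOptionSets K) {A B : Finset V} (hB : B ∈ K)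
    {x : V} (hx : x ∈ posi (A : Set V)) : B.erase x ∪ A ∈ K := by
  have hBA : B ∪ A ∈ K := hK.coherent.mono B _ hB Finset.subset_union_left
  refine hK.remove_posi _ _ hBA
    (Finset.union_subset_union_left (B.erase_subset x)) fun y hy => ?_
  obtain rfl | hyx := eq_or_ne y x
  · exact posi_mono (Finset.coe_subset.2 Finset.subset_union_right) hx
  · exact subset_posi _ (by simpa [hyx] using hy)

open scoped Classical in
theorem MixingOptionSets.mixingOptions_of_minimal (hK : MixingOptionSets K)
    (hD : Minimal (K ⊆ binaryOptionSets ·) D) : MixingOptions D where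
  coherent := hK.coherent.coherentOptions_of_minimal hD
  mixing := by
    rintro A ⟨x, hxA, hxD⟩
    obtain ⟨B, hB, hBD⟩ := exists_mem_inter_eq_singleton hD hxD
    obtain ⟨y, hy, hyD⟩ := hD.prop (hK.erase_union_mem hB hxA)
    obtain hyB | hyA := Finset.mem_union.1 hy
    · have hyx : y = x := hBD.subset ⟨Finset.mem_of_mem_erase hyB, hyD⟩
      exact absurd hyx (Finset.ne_of_mem_erase hyB)
    · exact ⟨y, hyA, hyD⟩

theorem MixingOptionSets.exists_mixingOptions_of_notMem (hK : MixingOptionSets K)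
    {A : Finset V} (hA : A ∉ K) :
    ∃ D, MixingOptions D ∧ K ⊆ binaryOptionSets D ∧ A ∉ binaryOptionSets D := by
  have hKA : K ⊆ binaryOptionSets (A : Set V)ᶜ := fun B hB =>
    Set.not_subset.1 fun hBA => hA (hK.coherent.mono B A hB (by exact_mod_cast hBA))
  obtain ⟨D, hDA, hD⟩ := exists_subset_minimal_transversal hKA
  exact ⟨D, hK.mixingOptions_of_minimal hD, hD.prop, fun ⟨x, hxA, hxD⟩ => hDA hxD hxA⟩

theorem MixingOptionSets.isMixingRepresentation (hK : MixingOptionSets K) :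
    IsMixingRepresentation K {D | MixingOptions D ∧ K ⊆ binaryOptionSets D} where
  nonempty :=
    let ⟨D, hD, hKD, _⟩ := hK.exists_mixingOptions_of_notMem hK.coherent.zero_notMem
    ⟨D, hD, hKD⟩
  mixing _ hD := hD.1
  eq_iInter := by
    refine Set.Subset.antisymm (Set.subset_iInter₂ fun D hD => hD.2) fun A hA => ?_
    by_contra hAK
    obtain ⟨D, hD, hKD, hAD⟩ := hK.exists_mixingOptions_of_notMem hAK
    exact hAD (Set.mem_iInter₂.1 hA D ⟨hD, hKD⟩)

theorem IsMixingRepresentation.subset (h : IsMixingRepresentation K 𝒟) :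
    𝒟 ⊆ {D | MixingOptions D ∧ K ⊆ binaryOptionSets D} := fun D hD =>
  ⟨h.mixing D hD, h.eq_iInter.subset.trans (Set.iInter₂_subset D hD)⟩

end Mixing

end ChoiceModels

theorem mainTheorem3_general {V : Type*} [AddCommGroup V] [Module ℝ V] [PartialOrder V] :
    (∀ K : Set (Finset V),
      ChoiceModels.MixingOptionSets K ↔
        ∃ 𝒟 : Set (Set V), ChoiceModels.IsMixingRepresentation K 𝒟) ∧
    (∀ K : Set (Finset V), ChoiceModels.MixingOptionSets K →
      IsGreatest {𝒟 : Set (Set V) | ChoiceModels.IsMixingRepresentation K 𝒟}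
        {D : Set V | ChoiceModels.MixingOptions D ∧ K ⊆ ChoiceModels.binaryOptionSets D}) ∧
    (∀ D : Set V,
      ChoiceModels.MixingOptions D ↔ ChoiceModels.LexicographicOptions D) :=
  ⟨fun _ => ⟨fun hK => ⟨_, hK.isMixingRepresentation⟩, fun ⟨_, h⟩ => h.mixingOptionSets⟩,
    fun _ hK => ⟨hK.isMixingRepresentation, fun _ h => h.subset⟩,
    fun _ => ChoiceModels.mixingOptions_iff_lexicographicOptions⟩

theorem mainTheorem3 {V : Type*} [AddCommGroup V] [Module ℝ V]
    [PartialOrder V] [IsOrderedAddMonoid V] [PosSMulMono ℝ V] :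
    (∀ K : Set (Finset V),
      ChoiceModels.MixingOptionSets K ↔
        ∃ 𝒟 : Set (Set V), ChoiceModels.IsMixingRepresentation K 𝒟) ∧
    (∀ K : Set (Finset V), ChoiceModels.MixingOptionSets K →
      IsGreatest {𝒟 : Set (Set V) | ChoiceModels.IsMixingRepresentation K 𝒟}
        {D : Set V | ChoiceModels.MixingOptions D ∧ K ⊆ ChoiceModels.binaryOptionSets D}) ∧
    (∀ D : Set V,
      ChoiceModels.MixingOptions D ↔ ChoiceModels.LexicographicOptions D) :=
  mainTheorem3_general
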